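/- A \emph{solution} is a pair $(X,r)$, where $X$ is a non-empty set and $r:X\times X\to X\times X$, $r(x,y)=(\sigma_x(y),\tau_y(x))$, is a bijection such that $(r\times 1)(1\times r)(r\times 1)=(1\times r)(r\times 1)(1\times r)$ on $X\times X\times X$, $r^2=\mathrm{id}$, and all the maps $\sigma_x,\tau_y:X\to X$ are bijections (that is, an involutive non-degenerate set-theoretic solution of the Yang--Baxter equation). Its \emph{permutation group} is the group of permutations of $X$ generated by all the $\sigma_x$, $x\in X$; the solution is \emph{indecomposable} if this group acts transitively on $X$. Two solutions $(X,r)$ and $(Y,s)$ are \emph{isomorphic} if there is a bijection $f:X\to Y$ with $(f\times f)\circ r=s\circ (f\times f)$. Let $p\neq q$ be prime numbers and let $G$ be a group of order $pq$. Then: \begin{enumerate} \item If $G$ is cyclic, there is, up to isomorphism, exactly one indecomposable solution whose permutation group is isomorphic to $G$. \item If $G$ is a semidirect product $\mathbb{Z}_p\rtimes\mathbb{Z}_q$ for a non-trivial action of $\mathbb{Z}_q$ on $\mathbb{Z}_p$ by automorphisms (such an action exists only if $p\equiv 1\pmod q$), there are, up to isomorphism, exactly $q-1$ indecomposable solutions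 whose permutation group is isomorphic to $G$. \end{enumerate} In both cases, every indecomposable solution $(X,r)$ whose permutation group is isomorphic to $G$ satisfies $|X|=pq$. -/

import Mathlib

universe u v

/-- A (set-theoretic, non-degenerate, involutive) solution of the Yang-Baxter equation on a
non-empty set `X`: a bijection `r : X × X → X × X`, `r (x, y) = (σ_x y, τ_y x)`, which satisfies
the braid equation and `r² = id`, and for which all the maps `σ_x` and `τ_y` are bijections. -/
structure YBSolution (X : Type u) where
  nonempty : Nonempty X
  r : X × X → X × X
  bijective : Function.Bijective r
  /-- `(r × 1)(1 × r)(r × 1) = (1 × r)(r × 1)(1 × r)` as maps of `X × X × X`. -/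
  braid :
    let r₁₂ : X × X × X → X × X × X := fun t =>
      ((r (t.1, t.2.1)).1, (r (t.1, t.2.1)).2, t.2.2)
    let r₂₃ : X × X × X → X × X × X := fun t => (t.1, r t.2)
    r₁₂ ∘ r₂₃ ∘ r₁₂ = r₂₃ ∘ r₁₂ ∘ r₂₃
  sigma_bijective : ∀ x : X, Function.Bijective fun y : X => (r (x, y)).1
  tau_bijective : ∀ y : X, Function.Bijective fun x : X => (r (x, y)).2
  involutive : r ∘ r = id

namespace YBSolution

variable {X : Type u}

/-- The permutation `σ_x` of `X`, where `r (x, y) = (σ_x y, τ_y x)`. -/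
noncomputable def sigma (S : YBSolution X) (x : X) : Equiv.Perm X :=
  Equiv.ofBijective (fun y : X => (S.r (x, y)).1) (S.sigma_bijective x)

/-- The permutation group of a solution: the group generated by the permutations `σ_x`. -/
def permutationGroup (S : YBSolution X) : Subgroup (Equiv.Perm X) :=
  Subgroup.closure (Set.range S.sigma)

/-- A solution is indecomposable if its permutation group acts transitively on `X`. -/
def IsIndecomposable (S : YBSolution X) : Prop :=
  MulAction.IsPretransitive S.permutationGroup X

/-- Two solutions `(X, r)`, `(Y, s)` are isomorphic if there is a bijection `f : X → Y` with
`(f × f) ∘ r = s ∘ (f × f)`. -/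
def IsIsomorphic {X Y : Type u} (S : YBSolution X) (T : YBSolution Y) : Prop :=
  ∃ f : X ≃ Y, Prod.map f f ∘ S.r = T.r ∘ Prod.map f f

theorem IsIsomorphic.refl (S : YBSolution X) : S.IsIsomorphic S :=
  ⟨Equiv.refl X, by funext p; rfl⟩

theorem IsIsomorphic.symm {X Y : Type u} {S : YBSolution X} {T : YBSolution Y}
    (h : S.IsIsomorphic T) : T.IsIsomorphic S := by
  obtain ⟨f, hf⟩ := h
  refine ⟨f.symm, ?_⟩
  funext p
  have h1 := congrFun hf (f.symm p.1, f.symm p.2)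
  simp only [Function.comp_apply, Prod.map_apply, Equiv.apply_symm_apply] at h1
  simp [← h1, Prod.map]

theorem IsIsomorphic.trans {X Y Z : Type u} {S : YBSolution X} {T : YBSolution Y}
    {R : YBSolution Z} (h : S.IsIsomorphic T) (h' : T.IsIsomorphic R) : S.IsIsomorphic R := by
  obtain ⟨f, hf⟩ := h
  obtain ⟨g, hg⟩ := h'
  refine ⟨f.trans g, ?_⟩
  funext p
  have h1 := congrFun hf p
  have h2 := congrFun hg (Prod.map f f p)
  simp only [Function.comp_apply] at h1 h2 ⊢
  rw [← h1] at h2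
  simpa [Prod.map] using h2

end YBSolution

/-- The indecomposable solutions (on arbitrary sets of the universe `u`) whose permutation group
is isomorphic to `G`. -/
def IndecomposableSolution (G : Type v) [Group G] : Type (u + 1) :=
  {S : (X : Type u) × YBSolution X //
    S.2.IsIndecomposable ∧ Nonempty (S.2.permutationGroup ≃* G)}

/-- Isomorphism of solutions, as an equivalence relation on the indecomposable solutions with
permutation group `G`. -/
def indecomposableSolutionSetoid (G : Type v) [Group G] :
    Setoid (IndecomposableSolution.{u, v} G) where
  r S T := S.1.2.IsIsomorphic T.1.2
  iseqv := ⟨fun S => YBSolution.IsIsomorphic.refl S.1.2, fun h => h.symm, fun h h' => h.trans h'⟩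

/-- The isomorphism classes of indecomposable solutions with permutation group `G`. -/
def IndecomposableSolutionClass (G : Type v) [Group G] : Type (u + 1) :=
  Quotient (indecomposableSolutionSetoid.{u, v} G)

/-- `G` is a (non-trivial) semidirect product `ℤ_p ⋊ ℤ_q`, for some non-trivial action of `ℤ_q`
on `ℤ_p` by automorphisms. -/
def IsNontrivialSemidirectProduct (p q : ℕ) (G : Type v) [Group G] : Prop :=
  ∃ φ : Multiplicative (ZMod q) →* MulAut (Multiplicative (ZMod p)),
    φ ≠ 1 ∧ Nonempty (G ≃* Multiplicative (ZMod p) ⋊[φ] Multiplicative (ZMod q))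

/-! ### The brace of a solution: an additive structure on its permutation group. -/

namespace YBSolution

variable {X : Type u}

/-! The permutation group also carries an abelian group law A, making it a brace: `sumPerm` sends
formal sums of points to permutations by a cocycle rule, and its fibres form a congruence
(`exists_cocycle`). The group acts on A, permuting the classes of the points, which generate A.
Under transitivity these generators have equal order; since |A| = pq with p ≠ q, each generates A.
So A = ℤ/pq, the action is multiplication by a character c, and b(σ_{g x₀}) = c(g)
(`exists_zmod_cocycle`). This makes the stabiliser of x₀ trivial, so |X| = pq (`bijective_apply`).

In coordinates ℤ/p × ℤ/q, c(g) = (w^k, 1), where k is the second coordinate of b(g) and w^q = 1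
(`eq_one_of_commute`, `exists_unitPow_of_lt`), so the solution is `affineSolution w`. As w = 1
exactly when the group is abelian, w has the same order as the unit v defining G. Conversely each
such w is realised (`nonempty_permutationGroup_mulEquiv`), and different w are not isomorphic
(`eq_of_affineSolution_isIsomorphic`). Since (ℤ/p)ˣ is cyclic, the count is the totient of the order
of v: 1 or q - 1. -/

theorem sigma_mem (S : YBSolution X) (x : X) : S.sigma x ∈ S.permutationGroup :=
  Subgroup.subset_closure ⟨x, rfl⟩

theorem sigma_sigma_tau (S : YBSolution X) (x y : X) :
    S.sigma (S.sigma x y) (S.r (x, y)).2 = x :=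
  congrArg Prod.fst (congrFun S.involutive (x, y))

theorem tau_eq (S : YBSolution X) (x y : X) :
    (S.r (x, y)).2 = (S.sigma (S.sigma x y))⁻¹ x := by
  rw [Equiv.Perm.eq_inv_iff_eq]
  exact S.sigma_sigma_tau x y

theorem sigma_mul_sigma (S : YBSolution X) (x y : X) :
    S.sigma x * S.sigma y = S.sigma (S.sigma x y) * S.sigma ((S.sigma (S.sigma x y))⁻¹ x) := by
  ext z
  rw [← tau_eq]
  exact (congrArg Prod.fst (congrFun S.braid (x, y, z))).symm

theorem sigma_mul_comm (S : YBSolution X) (x y : X) :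
    S.sigma x * S.sigma ((S.sigma x)⁻¹ y) = S.sigma y * S.sigma ((S.sigma y)⁻¹ x) := by
  simpa using S.sigma_mul_sigma x ((S.sigma x)⁻¹ y)

theorem isIsomorphic_iff {Y : Type u} (S : YBSolution X) (T : YBSolution Y) :
    S.IsIsomorphic T ↔ ∃ f : X ≃ Y, ∀ x y, f (S.sigma x y) = T.sigma (f x) (f y) := by
  refine exists_congr fun f => ⟨fun h x y => congrArg Prod.fst (congrFun h (x, y)), fun h => ?_⟩
  funext ⟨x, y⟩
  refine Prod.ext (h x y) ?_
  change f (S.r (x, y)).2 = (T.r (f x, f y)).2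
  rw [T.tau_eq, Equiv.Perm.eq_inv_iff_eq, ← h, ← h, S.sigma_sigma_tau]

/-- The right translation by the generator `x` for the additive structure of the permutation
group. -/
noncomputable def addStep (S : YBSolution X) (g : Equiv.Perm X) (x : X) : Equiv.Perm X :=
  g * S.sigma (g⁻¹ x)

/-- This is where the braid relation makes addition commutative: `sigma_mul_comm` at the points g⁻¹x
and g⁻¹y. -/
instance (S : YBSolution X) : RightCommutative S.addStep where
  right_comm g x y := by
    simp only [addStep, mul_assoc, mul_inv_rev, Equiv.Perm.mul_apply]
    rw [S.sigma_mul_comm]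

/-- The permutation attached to a formal sum of elements of `X`; it satisfies the cocycle
identity `sumPerm_add`. -/
noncomputable def sumPerm (S : YBSolution X) (m : Multiset X) : Equiv.Perm X :=
  m.foldl S.addStep 1

theorem foldl_addStep (S : YBSolution X) (g h : Equiv.Perm X) (m : Multiset X) :
    (m.map g).foldl S.addStep (g * h) = g * m.foldl S.addStep h := by
  induction m using Multiset.induction generalizing h with
  | empty => simp
  | cons x m ih =>
    rw [Multiset.map_cons, Multiset.foldl_cons, Multiset.foldl_cons, ← ih]
    simp [addStep, mul_assoc]

@[simp] theorem sumPerm_zero (S : YBSolution X) : S.sumPerm 0 = 1 := rfl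

@[simp] theorem sumPerm_singleton (S : YBSolution X) (x : X) : S.sumPerm {x} = S.sigma x := by
  rw [sumPerm, ← Multiset.cons_zero, Multiset.foldl_cons, Multiset.foldl_zero]
  simp [addStep]

theorem sumPerm_add (S : YBSolution X) (m k : Multiset X) :
    S.sumPerm (m + k.map (S.sumPerm m)) = S.sumPerm m * S.sumPerm k := by
  have := S.foldl_addStep (S.sumPerm m) 1 k
  rw [sumPerm, Multiset.foldl_add]
  simpa [sumPerm] using this

theorem sumPerm_add' (S : YBSolution X) (m k : Multiset X) :
    S.sumPerm (m + k) = S.sumPerm m * S.sumPerm (k.map ⇑(S.sumPerm m)⁻¹) := by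
  rw [← sumPerm_add, Multiset.map_map]
  simp

theorem sumPerm_mem (S : YBSolution X) (m : Multiset X) : S.sumPerm m ∈ S.permutationGroup := by
  have key : ∀ g ∈ S.permutationGroup, m.foldl S.addStep g ∈ S.permutationGroup := by
    induction m using Multiset.induction with
    | empty => simp
    | cons x m ih =>
      intro g hg
      rw [Multiset.foldl_cons]
      exact ih _ (mul_mem hg (S.sigma_mem _))
  exact key 1 (one_mem _)

/-- Finiteness removes the need for inverses: the σ_x generate the group as a monoid, and the
cocycle identity turns products into sums. -/
theorem exists_sumPerm_eq (S : YBSolution X) [Finite S.permutationGroup]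
    (g : Equiv.Perm X) (hg : g ∈ S.permutationGroup) : ∃ m, S.sumPerm m = g := by
  have hfin : ∀ h ∈ Set.range S.sigma, IsOfFinOrder h := by
    intro h hh
    have := isOfFinOrder_of_finite (⟨h, Subgroup.subset_closure hh⟩ : S.permutationGroup)
    exact (Submonoid.isOfFinOrder_coe (H := S.permutationGroup.toSubmonoid)).2 this
  rw [permutationGroup, ← Subgroup.mem_toSubmonoid,
    Subgroup.closure_toSubmonoid_of_isOfFinOrder hfin] at hg
  induction hg using Submonoid.closure_induction with
  | mem x hx => obtain ⟨y, rfl⟩ := hx; exact ⟨{y}, by simp⟩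
  | one => exact ⟨0, rfl⟩
  | mul a b _ _ ha hb =>
    obtain ⟨m, rfl⟩ := ha
    obtain ⟨k, rfl⟩ := hb
    exact ⟨_, S.sumPerm_add m k⟩

/-- Formal sums are congruent when they define the same permutation. -/
noncomputable def sumCon (S : YBSolution X) : AddCon (Multiset X) where
  toSetoid := Setoid.ker S.sumPerm
  add' {a b c d} hab hcd := by
    simp only [Setoid.ker_def] at *
    -- By `sumPerm_add'`, the value on a sum sees its first summand only through its permutation;
    -- commutativity gives the same for the second.
    rw [S.sumPerm_add' a c, hab, ← S.sumPerm_add', add_comm, S.sumPerm_add' c b, hcd,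
      ← S.sumPerm_add', add_comm]

theorem sumCon_iff (S : YBSolution X) {a b : Multiset X} :
    S.sumCon a b ↔ S.sumPerm a = S.sumPerm b := Iff.rfl

theorem exists_add_eq_zero (S : YBSolution X) [Finite S.permutationGroup]
    (a : S.sumCon.Quotient) : ∃ b, b + a = 0 := by
  induction a using AddCon.induction_on with
  | H m =>
    obtain ⟨k, hk⟩ := S.exists_sumPerm_eq _ (inv_mem (S.sumPerm_mem m))
    refine ⟨(k.map (S.sumPerm m) : Multiset X), ?_⟩
    rw [← AddCon.coe_add, ← AddCon.coe_zero, AddCon.eq, sumCon_iff, add_comm, sumPerm_add, hk]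
    simp

/-- The additive group of the permutation group. -/
@[reducible] noncomputable def sumGroup (S : YBSolution X) [Finite S.permutationGroup] :
    AddCommGroup S.sumCon.Quotient :=
  letI : Neg S.sumCon.Quotient := ⟨fun a => (S.exists_add_eq_zero a).choose⟩
  { (inferInstance : AddCommMonoid S.sumCon.Quotient) with
    zsmul := zsmulRec
    neg_add_cancel := fun a => (S.exists_add_eq_zero a).choose_spec }

/-- The brace structure of the permutation group of a solution, presented as a bijective
1-cocycle with values in an abelian group. -/
theorem exists_cocycle (S : YBSolution X) [Finite S.permutationGroup] :
    ∃ (A : Type u) (_ : AddCommGroup A) (b : S.permutationGroup ≃ A)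
      (l : S.permutationGroup → A →+ A) (a : X → A),
      (∀ g h, b (g * h) = b g + l g (b h)) ∧ (∀ g x, l g (a x) = a (g.1 x)) ∧
      (∀ g h : S.permutationGroup, ∀ z, l (g * h) z = l g (l h z)) ∧
      (∀ x, b ⟨S.sigma x, S.sigma_mem x⟩ = a x) ∧
      AddSubgroup.closure (Set.range a) = ⊤ := by
  let _ := S.sumGroup
  let e : S.sumCon.Quotient → S.permutationGroup := fun z =>
    AddCon.liftOn z (fun m => ⟨S.sumPerm m, S.sumPerm_mem m⟩) fun _ _ h => Subtype.ext h
  have e_coe : ∀ m : Multiset X, e m = ⟨S.sumPerm m, S.sumPerm_mem m⟩ := fun _ => rfl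
  have he : Function.Bijective e := by
    constructor
    · intro z w h
      induction z using AddCon.induction_on with
      | H m =>
        induction w using AddCon.induction_on with
        | H k => exact (AddCon.eq _).2 (Subtype.ext_iff.1 h)
    · rintro ⟨g, hg⟩
      obtain ⟨m, rfl⟩ := S.exists_sumPerm_eq g hg
      exact ⟨m, rfl⟩
  let b := (Equiv.ofBijective e he).symm
  have b_sum : ∀ m : Multiset X, b ⟨S.sumPerm m, S.sumPerm_mem m⟩ = m := fun m =>
    (Equiv.ofBijective e he).symm_apply_apply (m : S.sumCon.Quotient)
  have key : ∀ (g : S.permutationGroup) (m : Multiset X),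
      b (g * ⟨S.sumPerm m, S.sumPerm_mem m⟩) =
        b g + ((m.map g.1 : Multiset X) : S.sumCon.Quotient) := by
    rintro ⟨g, hg⟩ m
    obtain ⟨k, rfl⟩ := S.exists_sumPerm_eq g hg
    rw [b_sum, ← AddCon.coe_add, ← b_sum]
    exact congrArg b (Subtype.ext (S.sumPerm_add k m).symm)
  have l_coe : ∀ (g : S.permutationGroup) (m : Multiset X),
      b (g * e m) - b g = ((m.map g.1 : Multiset X) : S.sumCon.Quotient) := fun g m => by
    rw [e_coe, key, add_sub_cancel_left]
  -- The brace action λ_g(z) = g ∘ z - g. Defined through b it needs no descent to classes; `l_coe`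
  -- identifies it with moving points by g.
  let l : S.permutationGroup → S.sumCon.Quotient →+ S.sumCon.Quotient := fun g =>
    AddMonoidHom.mk' (fun z => b (g * e z) - b g) fun z w => by
      induction z, w using AddCon.induction_on₂ with
      | H m k => rw [← AddCon.coe_add, l_coe, l_coe, l_coe, Multiset.map_add, AddCon.coe_add]
  have hl : ∀ (g : S.permutationGroup) (m : Multiset X),
      l g m = ((m.map g.1 : Multiset X) : S.sumCon.Quotient) := l_coe
  refine ⟨S.sumCon.Quotient, inferInstance, b, l, fun x => (({x} : Multiset X) : S.sumCon.Quotient),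
    ?_, ?_, ?_, ?_, ?_⟩
  · intro g h
    have : e (b h) = h := (Equiv.ofBijective e he).apply_symm_apply h
    change _ = b g + (b (g * e (b h)) - b g)
    rw [this, add_sub_cancel]
  · intro g x
    rw [hl, Multiset.map_singleton]
  · intro g h z
    induction z using AddCon.induction_on with
    | H m => rw [hl, hl, hl, Multiset.map_map]; rfl
  · intro x
    exact (congrArg b (Subtype.ext (S.sumPerm_singleton x).symm)).trans (b_sum {x})
  · rw [eq_top_iff]
    rintro z -
    induction z using AddCon.induction_on with
    | H m =>
      induction m using Multiset.induction with
      | empty => exact zero_mem _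
      | cons x m ih =>
        rw [← Multiset.singleton_add, AddCon.coe_add]
        exact add_mem (AddSubgroup.subset_closure ⟨x, rfl⟩) ih

end YBSolution

/-! ### Cyclicity of the additive group and regularity of the action -/

namespace YBSolution

variable {X : Type u}

/-- In an abelian group whose order is a product of two distinct primes, a set of generators of
equal order consists of generators of the whole group. -/
theorem addOrderOf_eq_of_closure_eq_top {A : Type*} [AddCommGroup A] {p q : ℕ} (hp : p.Prime)
    (hq : q.Prime) (hpq : p ≠ q) (hA : Nat.card A = p * q) {ι : Type*} (a : ι → A)
    (ha : ∀ i j, addOrderOf (a i) = addOrderOf (a j))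
    (hgen : AddSubgroup.closure (Set.range a) = ⊤) (i : ι) : addOrderOf (a i) = p * q := by
  have : Finite A := Nat.finite_of_card_ne_zero (by rw [hA]; exact (mul_pos hp.pos hq.pos).ne')
  -- The common order of the generators annihilates A, so by Cauchy both p and q divide it.
  have kill : ∀ z : A, addOrderOf (a i) • z = 0 := by
    intro z
    have hz : z ∈ AddSubgroup.closure (Set.range a) := hgen ▸ AddSubgroup.mem_top z
    induction hz using AddSubgroup.closure_induction with
    | mem x hx => obtain ⟨j, rfl⟩ := hx; rw [ha i j, addOrderOf_nsmul_eq_zero]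
    | zero => simp
    | add x y _ _ hx hy => rw [nsmul_add, hx, hy, add_zero]
    | neg x _ hx => rw [smul_neg, hx, neg_zero]
  have hdvd : ∀ r : ℕ, r.Prime → r ∣ p * q → r ∣ addOrderOf (a i) := by
    intro r hr hrn
    have : Fact r.Prime := ⟨hr⟩
    obtain ⟨z, hz⟩ := exists_prime_addOrderOf_dvd_card' (G := A) r (hA ▸ hrn)
    rw [← hz]
    exact addOrderOf_dvd_of_nsmul_eq_zero (kill z)
  exact Nat.dvd_antisymm (hA ▸ addOrderOf_dvd_natCard (a i))
    (((Nat.coprime_primes hp hq).2 hpq).mul_dvd_of_dvd_of_dvd (hdvd p hp (dvd_mul_right p q))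
      (hdvd q hq (dvd_mul_left q p)))

/-- An indecomposable solution whose permutation group has order `p * q` corresponds to a brace
with additive group `ZMod (p * q)`, whose unit is the class of a given element. -/
theorem exists_zmod_cocycle {p q : ℕ} (hp : p.Prime) (hq : q.Prime) (hpq : p ≠ q)
    (S : YBSolution X) (hS : S.IsIndecomposable) (hcard : Nat.card S.permutationGroup = p * q)
    (x₀ : X) :
    ∃ (b : S.permutationGroup ≃ ZMod (p * q)) (c : S.permutationGroup →* ZMod (p * q)),
      (∀ g h, b (g * h) = b g + c g * b h) ∧
      ∀ g : S.permutationGroup, b ⟨S.sigma (g.1 x₀), S.sigma_mem _⟩ = c g := by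
  have hn : p * q ≠ 0 := (mul_pos hp.pos hq.pos).ne'
  have : NeZero (p * q) := ⟨hn⟩
  have : Finite S.permutationGroup := Nat.finite_of_card_ne_zero (hcard ▸ hn)
  obtain ⟨A, _, b, l, a, hb, hla, hl, hba, hgen⟩ := S.exists_cocycle
  have hA : Nat.card A = p * q := by rw [← hcard]; exact (Nat.card_congr b).symm
  have hl1 : ∀ z, l 1 z = z := by
    intro z
    have h := hb 1 (b.symm z)
    simp only [one_mul, Equiv.apply_symm_apply] at h
    have : b 1 = 0 := by simpa using (hb 1 (b.symm 0)).symm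
    rw [this, zero_add] at h
    exact h.symm
  have hdvd : ∀ (g : S.permutationGroup) x, addOrderOf (a (g.1 x)) ∣ addOrderOf (a x) := by
    intro g x
    rw [← hla]
    exact addOrderOf_map_dvd (l g) (a x)
  have hord : ∀ x y, addOrderOf (a x) = addOrderOf (a y) := by
    have key : ∀ x y, addOrderOf (a x) ∣ addOrderOf (a y) := by
      intro x y
      obtain ⟨g, hg⟩ := hS.exists_smul_eq y x
      have := hdvd g y
      rwa [show g.1 y = x from hg] at this
    exact fun x y => Nat.dvd_antisymm (key x y) (key y x)
  have ho := addOrderOf_eq_of_closure_eq_top hp hq hpq hA a hord hgen x₀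
  let ψ : ZMod (p * q) →+ A := ZMod.lift (p * q) ⟨zmultiplesHom A (a x₀), by
    rw [← ho]; simp [addOrderOf_nsmul_eq_zero]⟩
  have ψ_int : ∀ k : ℤ, ψ k = k • a x₀ := fun k => by simp [ψ]
  have ψ1 : ψ 1 = a x₀ := by simpa using ψ_int 1
  have hψ : Function.Bijective ψ := by
    have : Finite A := Finite.of_equiv _ b
    refine Function.Injective.bijective_of_nat_card_le ?_ (by simp [hA])
    rw [injective_iff_map_eq_zero]
    intro z hz
    obtain ⟨k, rfl⟩ := ZMod.intCast_surjective z
    rw [ψ_int, ← addOrderOf_dvd_iff_zsmul_eq_zero, ho] at hz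
    exact (ZMod.intCast_zmod_eq_zero_iff_dvd _ _).2 hz
  let e := AddEquiv.ofBijective ψ hψ
  have e_app : ∀ z, e z = ψ z := fun _ => rfl
  -- Endomorphisms of a cyclic group are multiplications by the image of the generator; this
  -- produces c.
  have lin : ∀ (f : A →+ A) z, f (e z) = e (e.symm (f (a x₀)) * z) := by
    intro f z
    obtain ⟨k, rfl⟩ := ZMod.intCast_surjective z
    rw [mul_comm (e.symm _), ← zsmul_eq_mul, map_zsmul, AddEquiv.apply_symm_apply, e_app, ψ_int, map_zsmul]
  let c : S.permutationGroup →* ZMod (p * q) :=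
    { toFun := fun g => e.symm (l g (a x₀))
      map_one' := by rw [hl1, AddEquiv.symm_apply_eq]; exact ψ1.symm
      map_mul' := fun g h => by
        rw [hl, AddEquiv.symm_apply_eq, ← lin, AddEquiv.apply_symm_apply] }
  have hc : ∀ g, c g = e.symm (l g (a x₀)) := fun _ => rfl
  refine ⟨b.trans e.symm.toEquiv, c, fun g h => ?_, fun g => ?_⟩
  · change e.symm (b (g * h)) = e.symm (b g) + c g * e.symm (b h)
    rw [hb, map_add, add_right_inj, AddEquiv.symm_apply_eq, hc, ← lin, AddEquiv.apply_symm_apply]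
  · change e.symm (b _) = _
    rw [hba, hc, hla]

section Regular

variable {n : ℕ} {x₀ : X} {S : YBSolution X} {b : S.permutationGroup ≃ ZMod n}
  {c : S.permutationGroup →* ZMod n}

/-- If h fixes x₀ then c(h) = 1, so b(g h g⁻¹) = c(g) b(h), which is b of a power of h. All
conjugates of h therefore fix x₀, and by transitivity h fixes every point. -/
theorem eq_one_of_apply_eq [NeZero n] (hS : S.IsIndecomposable)
    (hb : ∀ g h, b (g * h) = b g + c g * b h)
    (hc : ∀ g : S.permutationGroup, b ⟨S.sigma (g.1 x₀), S.sigma_mem _⟩ = c g)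
    (h : S.permutationGroup) (hh : h.1 x₀ = x₀) : h = 1 := by
  have c_one : c h = 1 := by
    rw [← hc, ← map_one c, ← hc 1]
    congr 2
    rw [hh]
    rfl
  have b_one : b 1 = 0 := by simpa using hb 1 1
  have b_pow : ∀ m : ℕ, b (h ^ m) = m * b h := by
    intro m
    induction m with
    | zero => simpa using b_one
    | succ m ih => rw [pow_succ, hb, ih, map_pow, c_one]; push_cast; ring
  have conj : ∀ g, ∃ m : ℕ, g * h * g⁻¹ = h ^ m := by
    intro g
    refine ⟨(c g).val, b.injective ?_⟩
    have e1 := hb (g * h * g⁻¹) g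
    have e2 : c (g * h * g⁻¹) = 1 := by
      rw [map_mul, map_mul, c_one, mul_one, ← map_mul, mul_inv_cancel, map_one]
    rw [inv_mul_cancel_right, hb, e2, one_mul, add_comm] at e1
    rw [b_pow, ZMod.natCast_zmod_val]
    exact (add_right_cancel e1).symm
  refine Subtype.ext (Equiv.ext fun y => ?_)
  obtain ⟨g, rfl⟩ := hS.exists_smul_eq x₀ y
  obtain ⟨m, hm⟩ := conj g⁻¹
  have hfix : h ^ m • x₀ = x₀ := by
    rw [← MulAction.mem_stabilizer_iff]
    exact pow_mem (show h ∈ MulAction.stabilizer S.permutationGroup x₀ from hh) m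
  change h • g • x₀ = g • x₀
  rw [← hm, inv_inv, mul_smul, mul_smul, inv_smul_eq_iff] at hfix
  exact hfix

/-- The permutation group of the solution acts regularly. -/
theorem bijective_apply [NeZero n] (hS : S.IsIndecomposable)
    (hb : ∀ g h, b (g * h) = b g + c g * b h)
    (hc : ∀ g : S.permutationGroup, b ⟨S.sigma (g.1 x₀), S.sigma_mem _⟩ = c g) :
    Function.Bijective fun g : S.permutationGroup => g.1 x₀ := by
  refine ⟨fun g h hgh => ?_, fun y => hS.exists_smul_eq x₀ y⟩
  refine (inv_mul_eq_one.1 (eq_one_of_apply_eq hS hb hc (g⁻¹ * h) ?_))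
  change g⁻¹ • h • x₀ = x₀
  rw [inv_smul_eq_iff]
  exact hgh.symm

end Regular

end YBSolution

/-! ### Determination of the character c -/

section AffineLaw

variable {p q : ℕ} {G : Type*} [Group G]

/-- The power of a unit with exponent in `ZMod q`. -/
def unitPow (u : (ZMod p)ˣ) (k : ZMod q) : (ZMod p)ˣ := u ^ k.val

theorem unitPow_add [NeZero q] {u : (ZMod p)ˣ} (hu : u ^ q = 1) (a b : ZMod q) :
    unitPow u (a + b) = unitPow u a * unitPow u b := by
  rw [unitPow, ZMod.val_add, ← pow_eq_pow_mod _ hu, pow_add, unitPow, unitPow]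

theorem unitPow_one [Fact q.Prime] (u : (ZMod p)ˣ) : unitPow u (1 : ZMod q) = u := by
  rw [unitPow, ZMod.val_one, pow_one]

theorem unitPow_zero (u : (ZMod p)ˣ) : unitPow u (0 : ZMod q) = 1 := by
  rw [unitPow, ZMod.val_zero, pow_zero]

theorem one_unitPow (k : ZMod q) : unitPow (1 : (ZMod p)ˣ) k = 1 := one_pow _

theorem unitPow_natCast [NeZero q] {u : (ZMod p)ˣ} (hu : u ^ q = 1) (m : ℕ) :
    unitPow u (m : ZMod q) = u ^ m := by
  rw [unitPow, ZMod.val_natCast, ← pow_eq_pow_mod _ hu]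

/-- The coordinates `b` on the group `G` identify it with the group of the maps
`(x, y) ↦ (a + v ^ k * x, k + y)` of `ZMod p × ZMod q`. -/
def IsAffineLaw (v : (ZMod p)ˣ) (b : G ≃ ZMod p × ZMod q) : Prop :=
  ∀ g h, b (g * h) =
    ((b g).1 + (unitPow v (b g).2 : ZMod p) * (b h).1, (b g).2 + (b h).2)

theorem IsAffineLaw.commute_iff [Fact q.Prime] [Fact p.Prime] {v : (ZMod p)ˣ}
    {b : G ≃ ZMod p × ZMod q} (hb : IsAffineLaw v b) :
    (∀ g h : G, g * h = h * g) ↔ v = 1 := by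
  constructor
  · intro h
    have := congrArg b (h (b.symm (0, 1)) (b.symm (1, 0)))
    simp only [hb _ _, Equiv.apply_symm_apply, unitPow_one, Prod.mk.injEq] at this
    exact Units.ext (by simpa using this.1)
  · rintro rfl g h
    apply b.injective
    rw [hb, hb]
    simp [one_unitPow, add_comm]

/-- Commuting with the element of coordinate 1 forces c to be z ↦ 1 + (u - 1)z in coordinates. Were
a component of u - 1 nonzero, some z would make that component of c vanish, but c takes unit values.
-/
theorem eq_one_of_commute [Fact p.Prime] [Fact q.Prime] {b : G ≃ ZMod p × ZMod q}
    {c : G →* ZMod p × ZMod q} (hb : ∀ g h, b (g * h) = b g + c g * b h)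
    (hcomm : ∀ g h : G, g * h = h * g) (g : G) : c g = 1 := by
  set u := c (b.symm 1) with hu
  have key : ∀ z, c (b.symm z) = 1 + (u - 1) * z := by
    intro z
    have h := congrArg b (hcomm (b.symm z) (b.symm 1))
    rw [hb, hb] at h
    simp only [Equiv.apply_symm_apply, mul_one] at h
    rw [← hu] at h
    linear_combination h
  have hunit : ∀ z, IsUnit (c z) := fun z => (Group.isUnit z).map c
  have u1 : u.1 = 1 := by
    by_contra hne
    have hne' : u.1 - 1 ≠ 0 := sub_ne_zero.2 hne
    have := (Prod.isUnit_iff.1 (hunit (b.symm (-(u.1 - 1)⁻¹, 0)))).1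
    rw [key] at this
    simp [mul_inv_cancel₀ hne'] at this
  have u2 : u.2 = 1 := by
    by_contra hne
    have hne' : u.2 - 1 ≠ 0 := sub_ne_zero.2 hne
    have := (Prod.isUnit_iff.1 (hunit (b.symm (0, -(u.2 - 1)⁻¹)))).2
    rw [key] at this
    simp [mul_inv_cancel₀ hne'] at this
  have hu1 : u = 1 := Prod.ext u1 u2
  simpa [hu1] using key (b g)

/-- Orders decide: q - 1 is prime to pq, so the ℤ/q component of c is trivial and the second
coordinate of b is a homomorphism β. The ℤ/p component has values of order dividing q, hence kills
the kernel of β, which has order p, and factors through β. -/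
theorem exists_unitPow_of_lt [Fact p.Prime] [Fact q.Prime] (hlt : q < p)
    {b : G ≃ ZMod p × ZMod q} {c : G →* ZMod p × ZMod q}
    (hb : ∀ g h, b (g * h) = b g + c g * b h) :
    ∃ u : (ZMod p)ˣ, u ^ q = 1 ∧ ∀ g, c g = ((unitPow u (b g).2 : ZMod p), 1) := by
  have hp : p.Prime := Fact.out
  have hq : q.Prime := Fact.out
  have hcard : Nat.card G = p * q := by rw [Nat.card_congr b]; simp
  have : Finite G := Finite.of_equiv _ b.symm
  have hcop : p.Coprime q := (Nat.coprime_primes hp hq).2 hlt.ne'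
  let c₁ : G →* (ZMod p)ˣ := ((MonoidHom.fst _ _).comp c).toHomUnits
  let c₂ : G →* (ZMod q)ˣ := ((MonoidHom.snd _ _).comp c).toHomUnits
  have hc : ∀ g, c g = ((c₁ g : ZMod p), (c₂ g : ZMod q)) := fun _ => rfl
  have sub_cop : ∀ {r : ℕ}, r.Prime → (r - 1).Coprime r := fun {r} hr => by
    have := Nat.coprime_self_sub_right (m := 1) (n := r) hr.one_le
    rw [Nat.coprime_comm, this]
    simp
  have hc₂ : ∀ g, c₂ g = 1 := by
    intro g
    rw [← orderOf_eq_one_iff]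
    have h1 : orderOf (c₂ g) ∣ q - 1 := by
      have := orderOf_dvd_natCard (c₂ g)
      rwa [Nat.card_eq_fintype_card, ZMod.card_units] at this
    have h2 : orderOf (c₂ g) ∣ p * q :=
      (orderOf_map_dvd c₂ g).trans (hcard ▸ orderOf_dvd_natCard g)
    have h3 : (q - 1).Coprime (p * q) := by
      refine Nat.Coprime.mul_right ?_ (sub_cop hq)
      refine (Nat.coprime_of_lt_prime ?_ ?_ hp).symm
      · have := hq.two_le
        omega
      · omega
    exact Nat.eq_one_of_dvd_coprimes h3 h1 h2
  have hc₁q : ∀ g, c₁ g ^ q = 1 := by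
    intro g
    have h1 : orderOf (c₁ g) ∣ p - 1 := by
      have := orderOf_dvd_natCard (c₁ g)
      rwa [Nat.card_eq_fintype_card, ZMod.card_units] at this
    have h2 : orderOf (c₁ g) ∣ p * q :=
      (orderOf_map_dvd c₁ g).trans (hcard ▸ orderOf_dvd_natCard g)
    exact orderOf_dvd_iff_pow_eq_one.1
      (((sub_cop hp).coprime_dvd_left h1).dvd_of_dvd_mul_left h2)
  have hb₂ : ∀ g h, (b (g * h)).2 = (b g).2 + (b h).2 := by
    intro g h
    rw [hb, hc, hc₂]
    simp
  let β : G →* Multiplicative (ZMod q) :=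
    MonoidHom.mk' (fun g => Multiplicative.ofAdd (b g).2) fun g h => by rw [hb₂]; rfl
  have hβ : ∀ g, β g = Multiplicative.ofAdd (b g).2 := fun _ => rfl
  have hβs : Function.Surjective β := fun k => ⟨b.symm (0, k.toAdd), by simp [hβ]⟩
  have hker : Nat.card β.ker = p := by
    have h1 := β.ker.card_mul_index
    rw [Subgroup.index_ker, MonoidHom.range_eq_top.2 hβs, hcard] at h1
    have : Nat.card (⊤ : Subgroup (Multiplicative (ZMod q))) = q := by simp
    rw [this] at h1
    exact Nat.eq_of_mul_eq_mul_right hq.pos h1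
  have hc₁ : ∀ g, (b g).2 = 0 → c₁ g = 1 := by
    intro g hg
    have hg' : g ∈ β.ker := by rw [MonoidHom.mem_ker, hβ, hg]; rfl
    have h1 : g ^ p = 1 := by
      have := pow_card_eq_one' (x := (⟨g, hg'⟩ : β.ker))
      rw [hker] at this
      exact congrArg Subtype.val this
    have h2 : c₁ g ^ p = 1 := by rw [← map_pow, h1, map_one]
    rw [← orderOf_eq_one_iff]
    exact Nat.eq_one_of_dvd_coprimes hcop (orderOf_dvd_of_pow_eq_one h2)
      (orderOf_dvd_of_pow_eq_one (hc₁q g))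
  have hdep : ∀ g h, β g = β h → c₁ g = c₁ h := by
    intro g h hgh
    have : c₁ (g⁻¹ * h) = 1 := by
      apply hc₁
      have : β (g⁻¹ * h) = 1 := by rw [map_mul, map_inv, hgh, inv_mul_cancel]
      exact this
    rwa [map_mul, map_inv, inv_mul_eq_one] at this
  refine ⟨c₁ (b.symm 1), hc₁q _, fun g => ?_⟩
  rw [hc, hc₂, unitPow, ← map_pow]
  have : c₁ g = c₁ (b.symm 1 ^ (b g).2.val) := by
    apply hdep
    rw [map_pow, hβ, hβ, Equiv.apply_symm_apply, ← ofAdd_nsmul]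
    simp
  rw [this]
  simp

end AffineLaw

/-! ### The model solutions -/

namespace YBSolution

/-- The solution on `ZMod p × ZMod q` with
`σ_(a, b) (c, d) = (u ^ b + u * c, 1 + d)` and `τ_(c, d) (a, b) = (u⁻¹ * a - u ^ d, b - 1)`. -/
def affineSolution {p q : ℕ} [Fact q.Prime] (w : {w : (ZMod p)ˣ // w ^ q = 1}) :
    YBSolution (ULift.{u} (ZMod p × ZMod q)) :=
  let r : ULift.{u} (ZMod p × ZMod q) × ULift.{u} (ZMod p × ZMod q) →
      ULift.{u} (ZMod p × ZMod q) × ULift.{u} (ZMod p × ZMod q) := fun z =>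
    (⟨(unitPow w.1 z.1.down.2 : ZMod p) + w.1 * z.2.down.1, 1 + z.2.down.2⟩,
      ⟨(w.1⁻¹ : (ZMod p)ˣ) * z.1.down.1 - unitPow w.1 z.2.down.2, z.1.down.2 - 1⟩)
  have pow_add_one : ∀ k : ZMod q, unitPow w.1 (1 + k) = w.1 * unitPow w.1 k := fun k => by
    rw [unitPow_add w.2, unitPow_one]
  have pow_sub_one : ∀ k : ZMod q, unitPow w.1 (k - 1) = w.1⁻¹ * unitPow w.1 k := fun k => by
    rw [eq_inv_mul_iff_mul_eq, ← pow_add_one, add_sub_cancel]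
  have hr : Function.Involutive r := by
    rintro ⟨⟨a, b⟩, ⟨c, d⟩⟩
    simp only [r, pow_add_one, pow_sub_one, Prod.mk.injEq, ULift.up.injEq]
    push_cast
    refine ⟨⟨?_, ?_⟩, ?_, ?_⟩
    · rw [mul_sub, Units.mul_inv_cancel_left]; ring
    · ring
    · rw [mul_add, Units.inv_mul_cancel_left]; ring
    · simp
  { nonempty := ⟨⟨0, 0⟩⟩
    r := r
    bijective := hr.bijective
    braid := by
      funext ⟨⟨a, b⟩, ⟨c, d⟩, ⟨e, f⟩⟩
      simp only [Function.comp_apply, r, pow_add_one, pow_sub_one, Prod.mk.injEq, ULift.up.injEq]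
      have h := w.1.mul_inv
      push_cast
      refine ⟨⟨?_, trivial⟩, ⟨by ring, by ring⟩, ?_, trivial⟩
      · linear_combination (unitPow w.1 b : ZMod p) * h
      · linear_combination (unitPow w.1 f : ZMod p) * h
    sigma_bijective := fun x => by
      refine ⟨fun y z h => ?_, fun y => ?_⟩
      · have h' : y.down.1 = z.down.1 ∧ y.down.2 = z.down.2 := by simpa [r] using h
        exact ULift.ext _ _ (Prod.ext h'.1 h'.2)
      · refine ⟨⟨(w.1⁻¹ : (ZMod p)ˣ) * (y.down.1 - unitPow w.1 x.down.2), y.down.2 - 1⟩, ?_⟩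
        simp [r]
    tau_bijective := fun y => by
      refine ⟨fun x z h => ?_, fun z => ?_⟩
      · have h' : x.down.1 = z.down.1 ∧ x.down.2 = z.down.2 := by simpa [r] using h
        exact ULift.ext _ _ (Prod.ext h'.1 h'.2)
      · refine ⟨⟨w.1 * (z.down.1 + unitPow w.1 y.down.2), z.down.2 + 1⟩, ?_⟩
        simp [r]
    involutive := hr.comp_self }

theorem affineSolution_sigma {p q : ℕ} [Fact q.Prime] (w : {w : (ZMod p)ˣ // w ^ q = 1})
    (x y : ULift.{u} (ZMod p × ZMod q)) :
    (affineSolution w).sigma x y =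
      ⟨(unitPow w.1 x.down.2 : ZMod p) + w.1 * y.down.1, 1 + y.down.2⟩ := rfl

end YBSolution

/-! ### Classification, realisation and pairwise non-isomorphism -/

namespace YBSolution

variable {p q : ℕ} [Fact p.Prime] [Fact q.Prime]

theorem orderOf_eq_of_eq_one_iff {M : Type*} [Monoid M] {x y : M} (hx : x ^ q = 1)
    (hy : y ^ q = 1) (h : x = 1 ↔ y = 1) : orderOf x = orderOf y := by
  by_cases hx1 : x = 1
  · rw [hx1, h.1 hx1]
  · rw [orderOf_eq_prime hx hx1, orderOf_eq_prime hy (fun h' => hx1 (h.2 h'))]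

theorem lt_of_pow_eq_one {v : (ZMod p)ˣ} (hv : v ^ q = 1) (hv1 : v ≠ 1) : q < p := by
  have h1 := orderOf_dvd_natCard v
  rw [Nat.card_eq_fintype_card, ZMod.card_units, orderOf_eq_prime hv hv1] at h1
  have h2 := (Fact.out : p.Prime).two_le
  have h3 := Nat.le_of_dvd (by omega) h1
  omega

/-- Classification of the indecomposable solutions with permutation group of order `p * q`. -/
theorem exists_isIsomorphic_affineSolution (hpq : p ≠ q) {G : Type*} [Group G] {v : (ZMod p)ˣ}
    (hv : v ^ q = 1) {bG : G ≃ ZMod p × ZMod q} (hG : IsAffineLaw v bG)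
    {X : Type u} (S : YBSolution X) (hS : S.IsIndecomposable) (φ : S.permutationGroup ≃* G) :
    ∃ w : {w : (ZMod p)ˣ // w ^ q = 1}, orderOf w.1 = orderOf v ∧
      S.IsIsomorphic (affineSolution w) := by
  have hp : p.Prime := Fact.out
  have hq : q.Prime := Fact.out
  have hcard : Nat.card S.permutationGroup = p * q := by
    rw [Nat.card_congr φ.toEquiv, Nat.card_congr bG]; simp
  obtain ⟨x₀⟩ := S.nonempty
  have : NeZero (p * q) := ⟨(mul_pos hp.pos hq.pos).ne'⟩
  obtain ⟨b₀, c₀, hb₀, hc₀⟩ := S.exists_zmod_cocycle hp hq hpq hS hcard x₀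
  have hreg := bijective_apply hS hb₀ hc₀
  let R := ZMod.chineseRemainder ((Nat.coprime_primes hp hq).2 hpq)
  let b : S.permutationGroup ≃ ZMod p × ZMod q := b₀.trans R.toEquiv
  let c : S.permutationGroup →* ZMod p × ZMod q := R.toMonoidHom.comp c₀
  have hb : ∀ g h, b (g * h) = b g + c g * b h := fun g h => by
    change R (b₀ (g * h)) = _
    rw [hb₀, map_add, map_mul]
    rfl
  have hc : ∀ g : S.permutationGroup, b ⟨S.sigma (g.1 x₀), S.sigma_mem _⟩ = c g := fun g =>
    congrArg R (hc₀ g)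
  have hcomm : (∀ g h : S.permutationGroup, g * h = h * g) ↔ v = 1 := by
    rw [← hG.commute_iff]
    refine ⟨fun h x y => ?_, fun h x y => φ.injective ?_⟩
    · simpa using congrArg φ (h (φ.symm x) (φ.symm y))
    · rw [map_mul, map_mul, h]
  obtain ⟨w, hw, hcw⟩ : ∃ w : (ZMod p)ˣ, w ^ q = 1 ∧
      ∀ g, c g = ((unitPow w (b g).2 : ZMod p), 1) := by
    by_cases hv1 : v = 1
    · refine ⟨1, one_pow q, fun g => ?_⟩
      rw [eq_one_of_commute hb (hcomm.2 hv1), one_unitPow]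
      rfl
    · exact exists_unitPow_of_lt (lt_of_pow_eq_one hv hv1) hb
  have hlaw : IsAffineLaw w b := fun g h => by
    rw [hb, hcw]
    ext <;> simp
  refine ⟨⟨w, hw⟩, orderOf_eq_of_eq_one_iff hw hv (hlaw.commute_iff.symm.trans hcomm), ?_⟩
  let E := Equiv.ofBijective _ hreg
  let f : X ≃ ULift.{u} (ZMod p × ZMod q) := E.symm.trans (b.trans Equiv.ulift.symm)
  have hf : ∀ g : S.permutationGroup, f (g.1 x₀) = ⟨b g⟩ := fun g =>
    congrArg (fun g => ULift.up (b g)) (E.symm_apply_apply g)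
  refine (S.isIsomorphic_iff _).2 ⟨f, fun x y => ?_⟩
  obtain ⟨g, rfl⟩ := hreg.2 x
  obtain ⟨h, rfl⟩ := hreg.2 y
  -- As σ_{g x₀} has coordinates c(g), the group law evaluated at σ_{g x₀} h is precisely the model
  -- formula.
  have := hf (⟨S.sigma (g.1 x₀), S.sigma_mem _⟩ * h)
  rw [hlaw, hc, hcw] at this
  simp only [unitPow_one] at this
  simp only [hf, affineSolution_sigma]
  exact this

section Realization

variable {w : {w : (ZMod p)ˣ // w ^ q = 1}}

/-- For w = 1 every σ is translation by (1, 1), a generator by the Chinese remainder theorem.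
Otherwise σ_(0,1) σ_(0,0)⁻¹ is translation by (w - 1, 0), which sweeps out the fibres, while σ_(0,0)
moves between them. -/
theorem affineSolution_mem_orbit (hpq : p ≠ q) (x : ULift.{u} (ZMod p × ZMod q)) :
    ∃ g ∈ (affineSolution.{u} w).permutationGroup, g ⟨0⟩ = x := by
  set S := affineSolution.{u} w
  have step : ∀ y z, (∃ g ∈ S.permutationGroup, g ⟨0⟩ = z) →
      ∃ g ∈ S.permutationGroup, g ⟨0⟩ = S.sigma y z := by
    rintro y _ ⟨g, hg, rfl⟩
    exact ⟨S.sigma y * g, mul_mem (S.sigma_mem y) hg, rfl⟩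
  have step' : ∀ y z, (∃ g ∈ S.permutationGroup, g ⟨0⟩ = S.sigma y z) →
      ∃ g ∈ S.permutationGroup, g ⟨0⟩ = z := by
    rintro y z ⟨g, hg, h⟩
    exact ⟨(S.sigma y)⁻¹ * g, mul_mem (inv_mem (S.sigma_mem y)) hg, by simp [h]⟩
  by_cases hw : w.1 = 1
  · have key : ∀ k : ℕ, ∃ g ∈ S.permutationGroup, g ⟨0⟩ = ⟨(k : ZMod p × ZMod q)⟩ := by
      intro k
      induction k with
      | zero => exact ⟨1, one_mem _, by simp⟩
      | succ k ih =>
        have := step ⟨0⟩ _ ih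
        rw [affineSolution_sigma, hw, one_unitPow] at this
        simp only [Units.val_one, one_mul] at this
        rw [Nat.cast_succ, add_comm]
        exact this
    let R := ZMod.chineseRemainder ((Nat.coprime_primes Fact.out Fact.out).2 hpq)
    have : NeZero (p * q) :=
      ⟨(mul_pos (Fact.out : p.Prime).pos (Fact.out : q.Prime).pos).ne'⟩
    have := key (R.symm x.down).val
    rwa [← map_natCast R, ZMod.natCast_zmod_val, RingEquiv.apply_symm_apply] at this
  · have hw' : (w.1 : ZMod p) - 1 ≠ 0 := sub_ne_zero.2 fun h => hw (Units.ext h)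
    have trans : ∀ (k : ℕ) (a : ZMod p) (d : ZMod q),
        (∃ g ∈ S.permutationGroup, g ⟨0⟩ = ⟨(a, d)⟩) →
        ∃ g ∈ S.permutationGroup, g ⟨0⟩ = ⟨(a + k * (w.1 - 1), d)⟩ := by
      intro k a d h
      induction k with
      | zero => simpa using h
      | succ k ih =>
        have h1 := step' ⟨0⟩ ⟨((w.1⁻¹ : (ZMod p)ˣ) * (a + k * (w.1 - 1) - 1), d - 1)⟩ (by
          rw [affineSolution_sigma]
          simp only [Prod.snd_zero, unitPow_zero, Units.val_one, Units.mul_inv_cancel_left,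
            add_sub_cancel]
          exact ih)
        have h2 := step ⟨(0, 1)⟩ _ h1
        rw [affineSolution_sigma] at h2
        simp only [unitPow_one, Units.mul_inv_cancel_left, add_sub_cancel] at h2
        convert h2 using 6
        push_cast
        ring
    have key : ∀ k : ℕ, ∃ a : ZMod p, ∃ g ∈ S.permutationGroup, g ⟨0⟩ = ⟨(a, (k : ZMod q))⟩ := by
      intro k
      induction k with
      | zero => exact ⟨0, 1, one_mem _, by simp; rfl⟩
      | succ k ih =>
        obtain ⟨a, ih⟩ := ih
        have := step ⟨0⟩ _ ih
        rw [affineSolution_sigma] at this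
        rw [Nat.cast_succ, add_comm]
        exact ⟨_, this⟩
    obtain ⟨a, ha⟩ := key x.down.2.val
    have := trans ((x.down.1 - a) / (w.1 - 1)).val _ _ ha
    rw [ZMod.natCast_zmod_val, ZMod.natCast_zmod_val, div_mul_cancel₀ _ hw', add_sub_cancel] at this
    exact this

theorem affineSolution_isIndecomposable (hpq : p ≠ q) :
    (affineSolution.{u} w).IsIndecomposable := by
  refine ⟨fun x y => ?_⟩
  obtain ⟨g, hg, rfl⟩ := affineSolution_mem_orbit (w := w) hpq x
  obtain ⟨h, hh, rfl⟩ := affineSolution_mem_orbit (w := w) hpq y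
  refine ⟨⟨h * g⁻¹, mul_mem hh (inv_mem hg)⟩, ?_⟩
  change (h * g⁻¹) (g _) = _
  simp

theorem exists_unitPow_eq {v : (ZMod p)ˣ} (hv : v ^ q = 1) (h : orderOf w.1 = orderOf v) :
    ∃ m : ZMod q, m ≠ 0 ∧ unitPow v m = w.1 := by
  by_cases hv1 : v = 1
  · rw [hv1, orderOf_one, orderOf_eq_one_iff] at h
    exact ⟨1, one_ne_zero, by rw [unitPow_one, hv1, h]⟩
  · have hq := orderOf_eq_prime hv hv1
    have hprim : IsPrimitiveRoot (v : ZMod p) q := by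
      rw [IsPrimitiveRoot.coe_units_iff, ← hq]
      exact IsPrimitiveRoot.orderOf v
    obtain ⟨i, -, hi⟩ := hprim.eq_pow_of_pow_eq_one (ξ := (w.1 : ZMod p))
      (by rw [← Units.val_pow_eq_pow_val, w.2, Units.val_one])
    have hi' : unitPow v (i : ZMod q) = w.1 := by
      rw [unitPow_natCast hv]
      exact Units.ext (by simpa using hi)
    refine ⟨i, fun h0 => ?_, hi'⟩
    rw [h0, unitPow_zero] at hi'
    rw [← hi', orderOf_one, hq] at h
    exact (Fact.out : q.Prime).one_lt.ne h

/-- Writing w = v^m with m ≠ 0, G acts faithfully by affine maps, with the ℤ/q coordinate rescaled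
by m⁻¹ so that each σ_x comes from an element (w^k, m). The image contains the permutation group,
and transitivity on pq points forces equality. -/
theorem nonempty_permutationGroup_mulEquiv (hpq : p ≠ q) {G : Type*} [Group G] {v : (ZMod p)ˣ}
    (hv : v ^ q = 1) {b : G ≃ ZMod p × ZMod q} (hb : IsAffineLaw v b)
    (hw : orderOf w.1 = orderOf v) :
    Nonempty ((affineSolution.{u} w).permutationGroup ≃* G) := by
  obtain ⟨m, hm, hmw⟩ := exists_unitPow_eq hv hw
  have b_one : b 1 = 0 := by
    have h := hb 1 1
    rw [mul_one] at h
    have h2 : (b 1).2 = 0 := by simpa using congrArg Prod.snd h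
    have h1 : (b 1).1 = 0 := by simpa [h2, unitPow_zero] using congrArg Prod.fst h
    exact Prod.ext h1 h2
  let ρ₀ : G →* Function.End (ULift.{u} (ZMod p × ZMod q)) :=
    { toFun := fun g x =>
        ⟨(b g).1 + (unitPow v (b g).2 : ZMod p) * x.down.1, m⁻¹ * (b g).2 + x.down.2⟩
      map_one' := by
        funext x
        simp [b_one, unitPow_zero]
        rfl
      map_mul' := fun g h => by
        funext x
        change _ = ULift.up _
        refine ULift.ext _ _ (Prod.ext ?_ ?_)
        · simp only [hb g h, unitPow_add hv]
          push_cast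
          ring
        · simp only [hb g h]
          ring }
  let ρ : G →* Equiv.Perm (ULift.{u} (ZMod p × ZMod q)) := ρ₀.toHomPerm
  have hρ : ∀ g x, ρ g x =
      ⟨(b g).1 + (unitPow v (b g).2 : ZMod p) * x.down.1, m⁻¹ * (b g).2 + x.down.2⟩ :=
    fun _ _ => rfl
  have hinj : Function.Injective ρ := by
    rw [injective_iff_map_eq_one]
    intro g hg
    have h := hρ g ⟨0⟩
    rw [hg] at h
    have h' := congrArg ULift.down h
    apply b.injective
    rw [b_one]
    exact Prod.ext (by simpa using (congrArg Prod.fst h').symm)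
      (by simpa [hm] using (congrArg Prod.snd h').symm)
  have hle : (affineSolution.{u} w).permutationGroup ≤ ρ.range := by
    refine (Subgroup.closure_le _).2 ?_
    rintro _ ⟨x, rfl⟩
    refine ⟨b.symm ((unitPow w.1 x.down.2 : ZMod p), m), Equiv.ext fun y => ?_⟩
    rw [hρ, affineSolution_sigma]
    simp [hmw, hm]
  have : Finite ρ.range := Finite.of_equiv _ (b.symm.trans (MonoidHom.ofInjective hinj).toEquiv)
  have : Finite (affineSolution.{u} w).permutationGroup :=
    Finite.of_injective _ (Subgroup.inclusion_injective hle)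
  have heq : (affineSolution.{u} w).permutationGroup = ρ.range := by
    refine Subgroup.eq_of_le_of_card_ge hle ?_
    rw [← Nat.card_congr (MonoidHom.ofInjective hinj).toEquiv, Nat.card_congr b,
      ← Nat.card_congr Equiv.ulift.{u}]
    refine Nat.card_le_card_of_surjective
      (fun g : (affineSolution.{u} w).permutationGroup => g.1 ⟨0⟩) fun x => ?_
    obtain ⟨g, hg, h⟩ := affineSolution_mem_orbit (w := w) hpq x
    exact ⟨⟨g, hg⟩, h⟩
  rw [heq]
  exact ⟨(MonoidHom.ofInjective hinj).symm⟩

end Realization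

/-- An isomorphism carries translation by (w - 1, 0) to translation by some (D, 0) with D ≠ 0.
Applying σ_(0,0) scales the former by w and the image by w', so wD = w'D. -/
theorem eq_of_affineSolution_isIsomorphic {w w' : {w : (ZMod p)ˣ // w ^ q = 1}}
    (hord : orderOf w.1 = orderOf w'.1)
    (h : (affineSolution.{u} w).IsIsomorphic (affineSolution.{u} w')) : w = w' := by
  apply Subtype.ext
  by_cases hw : w.1 = 1
  · rw [hw, orderOf_one, eq_comm, orderOf_eq_one_iff] at hord
    rw [hw, hord]
  have hw1 : (w.1 : ZMod p) - 1 ≠ 0 := sub_ne_zero.2 fun h => hw (Units.ext h)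
  obtain ⟨f, hf⟩ := (isIsomorphic_iff _ _).1 h
  let D : ZMod p := unitPow w'.1 (f ⟨(0, 1)⟩).down.2 - unitPow w'.1 (f ⟨0⟩).down.2
  have shift : ∀ (a : ZMod p) (d : ZMod q), f ⟨(a + (w.1 - 1), d)⟩ =
      ⟨((f ⟨(a, d)⟩).down.1 + D, (f ⟨(a, d)⟩).down.2)⟩ := by
    intro a d
    have h0 := hf ⟨0⟩ ⟨((w.1⁻¹ : (ZMod p)ˣ) * (a - 1), d - 1)⟩
    have h1 := hf ⟨(0, 1)⟩ ⟨((w.1⁻¹ : (ZMod p)ˣ) * (a - 1), d - 1)⟩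
    simp only [affineSolution_sigma, unitPow_one, Prod.snd_zero, unitPow_zero, Units.val_one,
      Units.mul_inv_cancel_left, add_sub_cancel] at h0 h1
    rw [show a + ((w.1 : ZMod p) - 1) = w.1 + (a - 1) by ring, h1, h0]
    refine ULift.ext _ _ (Prod.ext ?_ rfl)
    simp only [D]
    ring
  have shift_nat : ∀ (k : ℕ) (a : ZMod p) (d : ZMod q), f ⟨(a + k * (w.1 - 1), d)⟩ =
      ⟨((f ⟨(a, d)⟩).down.1 + k * D, (f ⟨(a, d)⟩).down.2)⟩ := by
    intro k a d
    induction k with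
    | zero => simp
    | succ k ih =>
      rw [show a + ((k + 1 : ℕ) : ZMod p) * ((w.1 : ZMod p) - 1) =
        a + k * (w.1 - 1) + (w.1 - 1) by push_cast; ring, shift, ih]
      refine ULift.ext _ _ (Prod.ext ?_ rfl)
      push_cast
      ring
  have hD : D ≠ 0 := by
    intro hD
    have h1 := shift 0 0
    rw [hD, add_zero] at h1
    have := congrArg (fun z => z.down.1) (f.injective (h1.trans rfl : _ = f ⟨(0, 0)⟩))
    simp only [zero_add] at this
    exact hw1 this
  have h0 := hf ⟨0⟩ ⟨(0, 0)⟩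
  have h1 := hf ⟨0⟩ ⟨(0 + (w.1 - 1), 0)⟩
  rw [shift] at h1
  have h2 := shift_nat (w.1 : ZMod p).val 1 1
  simp only [affineSolution_sigma, Prod.snd_zero, unitPow_zero, Units.val_one, mul_zero, add_zero,
    zero_add] at h0 h1
  rw [ZMod.natCast_zmod_val, h1, h0] at h2
  have h3 := congrArg (fun z => z.down.1) h2
  simp only at h3
  have : ((w'.1 : ZMod p) - w.1) * D = 0 := by linear_combination h3
  exact Units.ext (sub_eq_zero.1 ((mul_eq_zero.1 this).resolve_right hD)).symm

end YBSolution

/-! ### Affine coordinates on the given groups, and the count -/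

theorem exists_isAffineLaw_of_isCyclic {p q : ℕ} [Fact p.Prime] [Fact q.Prime] (hpq : p ≠ q)
    {G : Type*} [Group G] (hG : Nat.card G = p * q) [IsCyclic G] :
    ∃ b : G ≃ ZMod p × ZMod q, IsAffineLaw (1 : (ZMod p)ˣ) b := by
  let R := ZMod.chineseRemainder ((Nat.coprime_primes (Fact.out : p.Prime)
    (Fact.out : q.Prime)).2 hpq)
  let e : G ≃* Multiplicative (ZMod (p * q)) := mulEquivOfCyclicCardEq (by simp [hG])
  refine ⟨e.toEquiv.trans (Multiplicative.toAdd.trans R.toEquiv), fun g h => ?_⟩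
  have : R (e (g * h)).toAdd = R (e g).toAdd + R (e h).toAdd := by
    rw [map_mul, toAdd_mul, map_add]
  simp only [one_unitPow, Units.val_one, one_mul]
  exact this

/-- Automorphisms of ℤ/p are multiplications by units; v is the unit by which the generator 1 of ℤ/q
acts, and v ≠ 1 because the action is non-trivial. -/
theorem IsNontrivialSemidirectProduct.exists_isAffineLaw {p q : ℕ} [Fact p.Prime]
    [Fact q.Prime] {G : Type*} [Group G] (hG : IsNontrivialSemidirectProduct p q G) :
    ∃ v : (ZMod p)ˣ, orderOf v = q ∧ ∃ b : G ≃ ZMod p × ZMod q, IsAffineLaw v b := by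
  obtain ⟨φ, hφ, ⟨e⟩⟩ := hG
  let α : Multiplicative (ZMod q) → ZMod p →+ ZMod p := fun k =>
    AddMonoidHom.mk' (fun a => (φ k (Multiplicative.ofAdd a)).toAdd) fun a b => by
      rw [ofAdd_add, map_mul, toAdd_mul]
  have α_mul : ∀ k a, α k a = α k 1 * a := fun k a => by
    obtain ⟨m, rfl⟩ := ZMod.natCast_zmod_surjective a
    rw [mul_comm, ← nsmul_eq_mul, ← map_nsmul, nsmul_one]
  have α_app : ∀ k a, α k a = (φ k (Multiplicative.ofAdd a)).toAdd := fun _ _ => rfl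
  let c₀ : Multiplicative (ZMod q) →* ZMod p :=
    { toFun := fun k => α k 1
      map_one' := by rw [α_app, map_one]; rfl
      map_mul' := fun k l => by rw [← α_mul, α_app, α_app, α_app, map_mul]; rfl }
  let c := c₀.toHomUnits
  have hc : ∀ k, (c k : ZMod p) = α k 1 := fun _ => rfl
  let g : Multiplicative (ZMod q) := Multiplicative.ofAdd 1
  have hg : ∀ k : Multiplicative (ZMod q), g ^ k.toAdd.val = k := fun k => by
    rw [← ofAdd_nsmul, nsmul_one, ZMod.natCast_zmod_val, ofAdd_toAdd]
  have hck : ∀ k, c k = unitPow (c g) k.toAdd := fun k => by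
    rw [unitPow, ← map_pow, hg]
  have hgq : g ^ q = 1 := by rw [← ofAdd_nsmul, nsmul_one, ZMod.natCast_self, ofAdd_zero]
  refine ⟨c g, orderOf_eq_prime (by rw [← map_pow, hgq, map_one]) fun h1 => hφ ?_,
    e.toEquiv.trans (SemidirectProduct.equivProd.trans
      (Multiplicative.toAdd.prodCongr Multiplicative.toAdd)), fun x y => ?_⟩
  · refine MonoidHom.ext fun k => MulEquiv.ext fun a => ?_
    have : α k a.toAdd = a.toAdd := by
      rw [α_mul, ← hc, hck, h1, one_unitPow, Units.val_one, one_mul]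
    exact this
  · refine Prod.ext ?_ ?_
    · change (e (x * y)).left.toAdd = (e x).left.toAdd +
        (unitPow (c g) (e x).right.toAdd : ZMod p) * (e y).left.toAdd
      rw [← hck, hc, ← α_mul, map_mul, SemidirectProduct.mul_left, toAdd_mul]
      rfl
    · change (e (x * y)).right.toAdd = (e x).right.toAdd + (e y).right.toAdd
      rw [map_mul, SemidirectProduct.mul_right, toAdd_mul]

/-- The isomorphism classes of indecomposable solutions are parametrized by the units of order
`orderOf v`. -/
theorem card_indecomposableSolutionClass {p q : ℕ} [Fact p.Prime] [Fact q.Prime] (hpq : p ≠ q)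
    {G : Type v} [Group G] {v : (ZMod p)ˣ} (hv : v ^ q = 1) {b : G ≃ ZMod p × ZMod q}
    (hb : IsAffineLaw v b) :
    Nat.card (IndecomposableSolutionClass.{u, v} G) = (orderOf v).totient := by
  let U := {w : (ZMod p)ˣ // orderOf w = orderOf v}
  have pow_eq : ∀ w : U, w.1 ^ q = 1 := fun w => by
    rw [← orderOf_dvd_iff_pow_eq_one, w.2]
    exact orderOf_dvd_of_pow_eq_one hv
  let F : U → IndecomposableSolution.{u, v} G := fun w =>
    ⟨⟨_, YBSolution.affineSolution ⟨w.1, pow_eq w⟩⟩,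
      YBSolution.affineSolution_isIndecomposable hpq,
      YBSolution.nonempty_permutationGroup_mulEquiv hpq hv hb w.2⟩
  let Φ : U → IndecomposableSolutionClass.{u, v} G := fun w =>
    Quotient.mk (indecomposableSolutionSetoid.{u, v} G) (F w)
  have hΦ : Function.Bijective Φ := by
    constructor
    · intro w w' h
      have h' : (F w).1.2.IsIsomorphic (F w').1.2 := Quotient.exact h
      have := YBSolution.eq_of_affineSolution_isIsomorphic (w.2.trans w'.2.symm) h'
      exact Subtype.ext (congrArg (fun z => z.1) this)
    · intro z
      induction z using Quotient.inductionOn with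
      | h S =>
        obtain ⟨⟨X, S⟩, hS, ⟨φ⟩⟩ := S
        obtain ⟨w, hw, hiso⟩ :=
          YBSolution.exists_isIsomorphic_affineSolution hpq hv hb S hS φ
        exact ⟨⟨w.1, hw⟩, Quotient.sound (YBSolution.IsIsomorphic.symm hiso)⟩
  rw [← Nat.card_eq_of_bijective Φ hΦ, Nat.card_eq_fintype_card, Fintype.card_subtype]
  exact IsCyclic.card_orderOf_eq_totient (orderOf_dvd_card)

theorem mainTheorem1 (p q : ℕ) (hp : p.Prime) (hq : q.Prime) (hpq : p ≠ q)
    (G : Type v) [Group G] (hG : Nat.card G = p * q) :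
    (IsCyclic G →
      Nat.card (IndecomposableSolutionClass.{u, v} G) = 1) ∧
    (IsNontrivialSemidirectProduct p q G →
      Nat.card (IndecomposableSolutionClass.{u, v} G) = q - 1) ∧
    (IsCyclic G ∨ IsNontrivialSemidirectProduct p q G →
      ∀ (X : Type u) (S : YBSolution X), S.IsIndecomposable →
        Nonempty (S.permutationGroup ≃* G) → Nat.card X = p * q) := by
  have : Fact p.Prime := ⟨hp⟩
  have : Fact q.Prime := ⟨hq⟩
  refine ⟨fun hc => ?_, fun hs => ?_, fun _ X S hS hφ => ?_⟩
  · obtain ⟨b, hb⟩ := exists_isAffineLaw_of_isCyclic hpq hG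
    rw [card_indecomposableSolutionClass hpq (one_pow q) hb]
    simp
  · obtain ⟨v, hv, b, hb⟩ := hs.exists_isAffineLaw
    rw [card_indecomposableSolutionClass hpq (hv ▸ pow_orderOf_eq_one v) hb, hv,
      Nat.totient_prime hq]
  · obtain ⟨φ⟩ := hφ
    obtain ⟨x₀⟩ := S.nonempty
    have hcard : Nat.card S.permutationGroup = p * q := by rw [Nat.card_congr φ.toEquiv, hG]
    have : NeZero (p * q) := ⟨(mul_pos hp.pos hq.pos).ne'⟩
    obtain ⟨b, c, hb, hc⟩ := S.exists_zmod_cocycle hp hq hpq hS hcard x₀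
    rw [← hcard]
    exact (Nat.card_eq_of_bijective _ (YBSolution.bijective_apply hS hb hc)).symm
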